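/- Let $X\subset\mathbb{R}^d$ be a Borel set, let $h=(h_1,\dots,h_n):X\to\mathbb{R}^n$ be Borel measurable, and let $\mathcal{A}=\mathbb{R}[h_1,\dots,h_n]$ be the unital real algebra of functions on $X$ generated by $h_1,\dots,h_n$. Let $Q\subset\mathcal{A}$ be a quadratic module, i.e. a convex cone containing $1$ such that $sq\in Q$ for all $q\in Q$ and all sums of squares $s$ of elements of $\mathcal{A}$. Assume that $1$ lies in the algebraic interior of $Q$: for every $g\in\mathcal{A}$ there is $\varepsilon>0$ with $1+tg\in Q$ for all $0\le t<\varepsilon$. Put $$P(Q)=\{x\in X: q(x)\ge 0 \text{ for all } q\in Q\},\qquad \tilde Q=\{p\in\mathbb{R}[y_1,\dots,y_n]: p\circ h\in Q\},$$ $$P(\tilde Q)=\{y\in\mathbb{R}^n: p(y)\ge 0\text{ for all }p\in\tilde Q\}.$$ Assume that $h(X)$ is closed in $\mathbb{R}^n$. Then there are at most countable families $(v_i)_{i\in J}$ of polynomials in $\mathbb{R}[y_1,\dots,y_n]$ with $$\{y\in\mathbb{R}^n: v_i(y)\ge 0 \text{ for all } i\in J\}=h(X)\cap P(\tilde Q).$$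 Moreover, for every such family, every real $M>0$ and every $f\in\mathbb{R}[y_1,\dots,y_n]$ such that $f\circ h$ is (strictly) positive on $P(Q)$, there are a finite set $J_0\subset J$ and sums of squares of polynomials $\sigma,\sigma_0,\sigma_i\in\Sigma\mathbb{R}[y_1,\dots,y_n]^2$ $(i\in J_0)$ such that, on $X$, $$f\circ h=\sigma\circ h+(M-h_1^2-\cdots-h_n^2)\,(\sigma_0\circ h)+\sum_{i\in J_0}(v_i\circ h)\,(\sigma_i\circ h).$$ -/

import Mathlib

namespace FunctionAlgebra

/-- A quadratic module in a commutative real algebra `A`: a convex cone that contains `1` and is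
stable under multiplication by sums of squares of elements of `A`. -/
structure QuadModule (A : Type*) [CommRing A] [Algebra ℝ A] extends ConvexCone ℝ A where
  one_mem' : (1 : A) ∈ carrier
  sumSq_mul_mem' : ∀ s q : A, IsSumSq s → q ∈ carrier → s * q ∈ carrier

/-- `f` lies in the algebraic interior of the subset `C` of `A`: for every `g` there is `ε > 0`
such that `f + t g ∈ C` for all `0 ≤ t < ε`. -/
def InAlgebraicInterior {A : Type*} [CommRing A] [Algebra ℝ A] (C : Set A) (f : A) : Prop :=
  ∀ g : A, ∃ ε : ℝ, 0 < ε ∧ ∀ t : ℝ, 0 ≤ t → t < ε → f + t • g ∈ C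

/-- The preimage of a quadratic module under a homomorphism of real algebras. -/
def QuadModule.comap {A B : Type*} [CommRing A] [Algebra ℝ A] [CommRing B] [Algebra ℝ B]
    (φ : A →ₐ[ℝ] B) (Q : QuadModule B) : QuadModule A where
  carrier := {a | φ a ∈ Q.carrier}
  smul_mem' := by
    intro c hc a ha
    have h := Q.smul_mem' hc ha
    rwa [← map_smul] at h
  add_mem' := by
    intro a ha b hb
    have h := Q.add_mem' ha hb
    rwa [← map_add] at h
  one_mem' := by
    simpa using Q.one_mem'
  sumSq_mul_mem' := by
    intro s q hs hq
    have hφ : IsSumSq (φ s) := by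
      induction hs with
      | zero => simp
      | sq_add a _ ih =>
        rw [map_add, map_mul]
        exact IsSumSq.sq_add (φ a) ih
    have h := Q.sumSq_mul_mem' (φ s) (φ q) hφ hq
    rwa [← map_mul] at h

/-- The unital algebra `ℝ[h₁, …, hₙ]` of functions on `X` generated by the components of
`h = (h₁, …, hₙ)`. -/
def genAlgebra {X : Type*} {n : ℕ} (h : X → Fin n → ℝ) : Subalgebra ℝ (X → ℝ) :=
  Algebra.adjoin ℝ (Set.range fun (i : Fin n) (x : X) => h x i)

/-- The `i`-th generator `hᵢ` as an element of `ℝ[h₁, …, hₙ]`. -/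
def gen {X : Type*} {n : ℕ} (h : X → Fin n → ℝ) (i : Fin n) : genAlgebra h :=
  ⟨fun x => h x i, Algebra.subset_adjoin ⟨i, rfl⟩⟩

/-- The substitution map `ℝ[y₁, …, yₙ] → ℝ[h₁, …, hₙ]`, `p ↦ p ∘ h`. -/
noncomputable def subst {X : Type*} {n : ℕ} (h : X → Fin n → ℝ) :
    MvPolynomial (Fin n) ℝ →ₐ[ℝ] genAlgebra h :=
  MvPolynomial.aeval (gen h)

/-- `subst h p` is the function `p ∘ h`. -/
theorem subst_apply {X : Type*} {n : ℕ} (h : X → Fin n → ℝ) (p : MvPolynomial (Fin n) ℝ) (x : X) :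
    (subst h p : X → ℝ) x = MvPolynomial.eval (h x) p := by
  induction p using MvPolynomial.induction_on with
  | C a => simp [subst]
  | add p q hp hq => simp [hp, hq]
  | mul_X p i hp =>
    rw [map_mul, map_mul, MvPolynomial.eval_X, ← hp]
    simp [subst, gen]

/-- The positivity set `P(Q) ⊆ X` of a quadratic module of functions on `X`. -/
def posSet {X : Type*} {A : Subalgebra ℝ (X → ℝ)} (Q : QuadModule A) : Set X :=
  {x | ∀ q : A, q ∈ Q.carrier → 0 ≤ (q : X → ℝ) x}

/-- The positivity set `P(Q) ⊆ ℝⁿ` of a quadratic module of polynomials. -/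
def polyPosSet {n : ℕ} (Q : QuadModule (MvPolynomial (Fin n) ℝ)) : Set (Fin n → ℝ) :=
  {y | ∀ p : MvPolynomial (Fin n) ℝ, p ∈ Q.carrier → 0 ≤ MvPolynomial.eval y p}

end FunctionAlgebra

/-! The set `h(X) ∩ P(Q̃)` is closed, and a closed set is cut out by countably many polynomial
inequalities (`exists_nat_family_of_isClosed`). Given any such family `v`, a point with all `v i ≥
0` is `h x` with `x ∈ P(Q)`, because every element of `Q` is some `p ∘ h` with `p ∈ Q̃`. So `f > 0`
on the whole set `{v ≥ 0}`, hence on its part in the ball `|y|² ≤ M`, whatever `M` is. The ball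
polynomial makes the module generated with the `v i` archimedean, so Putinar's theorem represents
`f` in `ℝ[y]`; evaluating at `h x` gives the claim.

The Positivstellensatz is proved by convexity. If `f ∉ Q`, Riesz extension yields a state `L` with
`L f ≤ 0`. States form a compact set, so Krein–Milman gives an extreme state minimizing the value at
`f`. Extreme states are multiplicative, hence real points, which contradicts positivity of `f`. -/

namespace FunctionAlgebra

section Archimedean

variable {A : Type*} [CommRing A] [Algebra ℝ A]

/-! ### Bounded elements and archimedean modules. -/

namespace QuadModule

theorem sumSq_mem (Q : QuadModule A) {s : A} (hs : IsSumSq s) : s ∈ Q.carrier := by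
  simpa using Q.sumSq_mul_mem' s 1 hs Q.one_mem'

theorem zero_mem (Q : QuadModule A) : (0 : A) ∈ Q.carrier := Q.sumSq_mem .zero

theorem smul_mem_of_nonneg (Q : QuadModule A) {c : ℝ} (hc : 0 ≤ c) {a : A} (ha : a ∈ Q.carrier) :
    c • a ∈ Q.carrier := by
  rcases hc.eq_or_lt with rfl | hc
  · simpa using Q.zero_mem
  · exact Q.smul_mem' hc ha

theorem algebraMap_mem (Q : QuadModule A) {c : ℝ} (hc : 0 ≤ c) :
    algebraMap ℝ A c ∈ Q.carrier := by
  simpa [Algebra.algebraMap_eq_smul_one] using Q.smul_mem_of_nonneg hc Q.one_mem'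

theorem mul_self_mul_mem (Q : QuadModule A) (a : A) {q : A} (hq : q ∈ Q.carrier) :
    a * a * q ∈ Q.carrier := Q.sumSq_mul_mem' _ _ (IsSumSq.mul_self a) hq

/-- `a` is bounded with respect to `Q` if `N - a` and `N + a` lie in `Q` for some `N > 0`. -/
def IsBounded (Q : QuadModule A) (a : A) : Prop :=
  ∃ N : ℝ, 0 < N ∧ algebraMap ℝ A N - a ∈ Q.carrier ∧ algebraMap ℝ A N + a ∈ Q.carrier

/-- `Q` is archimedean if all elements of the algebra are bounded with respect to `Q`. -/
def IsArchimedean (Q : QuadModule A) : Prop := ∀ a : A, Q.IsBounded a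

variable {Q : QuadModule A}

theorem isBounded_algebraMap (Q : QuadModule A) (c : ℝ) : Q.IsBounded (algebraMap ℝ A c) := by
  refine ⟨|c| + 1, by positivity, ?_, ?_⟩
  · rw [← map_sub]
    exact Q.algebraMap_mem (by linarith [le_abs_self c])
  · rw [← map_add]
    exact Q.algebraMap_mem (by linarith [neg_abs_le c])

theorem IsBounded.neg {a : A} (ha : Q.IsBounded a) : Q.IsBounded (-a) := by
  obtain ⟨N, hN, h₁, h₂⟩ := ha
  exact ⟨N, hN, by simpa using h₂, by simpa [sub_eq_add_neg] using h₁⟩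

theorem IsBounded.add {a b : A} (ha : Q.IsBounded a) (hb : Q.IsBounded b) :
    Q.IsBounded (a + b) := by
  obtain ⟨N, hN, h₁, h₂⟩ := ha
  obtain ⟨K, hK, h₃, h₄⟩ := hb
  refine ⟨N + K, by positivity, ?_, ?_⟩
  · convert Q.add_mem' h₁ h₃ using 1
    rw [map_add]; ring
  · convert Q.add_mem' h₂ h₄ using 1
    rw [map_add]; ring

theorem IsBounded.smul {a : A} (c : ℝ) (ha : Q.IsBounded a) : Q.IsBounded (c • a) := by
  have key : ∀ {c : ℝ}, 0 ≤ c → Q.IsBounded (c • a) := by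
    intro c hc
    obtain ⟨N, hN, h₁, h₂⟩ := ha
    have h0 : algebraMap ℝ A 1 ∈ Q.carrier := Q.algebraMap_mem zero_le_one
    refine ⟨c * N + 1, by positivity, ?_, ?_⟩
    · convert Q.add_mem' (Q.smul_mem_of_nonneg hc h₁) h0 using 1
      rw [map_add, map_mul, smul_sub, Algebra.smul_def, Algebra.smul_def]; ring
    · convert Q.add_mem' (Q.smul_mem_of_nonneg hc h₂) h0 using 1
      rw [map_add, map_mul, smul_add, Algebra.smul_def, Algebra.smul_def]; ring
  rcases le_total 0 c with hc | hc
  · exact key hc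
  · simpa using (key (neg_nonneg.2 hc)).neg

theorem IsBounded.mul_self {a : A} (ha : Q.IsBounded a) : Q.IsBounded (a * a) := by
  obtain ⟨N, hN, h₁, h₂⟩ := ha
  refine ⟨N * N, by positivity, ?_, ?_⟩
  · have h := Q.smul_mem' (c := (2 * N)⁻¹) (by positivity)
      (Q.add_mem' (Q.mul_self_mul_mem (algebraMap ℝ A N + a) h₁)
        (Q.mul_self_mul_mem (algebraMap ℝ A N - a) h₂))
    convert h using 1
    -- The identity `(N+a)²(N-a) + (N-a)²(N+a) = 2N(N²-a²)` exhibits `N²-a²` in `Q`.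
    have e : (algebraMap ℝ A N + a) * (algebraMap ℝ A N + a) * (algebraMap ℝ A N - a) +
        (algebraMap ℝ A N - a) * (algebraMap ℝ A N - a) * (algebraMap ℝ A N + a) =
        (2 * N) • (algebraMap ℝ A (N * N) - a * a) := by
      rw [Algebra.smul_def, map_mul, map_mul, map_ofNat]; ring
    rw [e, inv_smul_smul₀ (by positivity)]
  · exact Q.add_mem' (Q.algebraMap_mem (by positivity)) (Q.sumSq_mem (.mul_self a))

theorem mul_eq_smul_sub (a b : A) :
    a * b = (4⁻¹ : ℝ) • ((a + b) * (a + b) + -((a - b) * (a - b))) := by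
  rw [eq_inv_smul_iff₀ (by norm_num), Algebra.smul_def, map_ofNat]; ring

theorem IsBounded.mul {a b : A} (ha : Q.IsBounded a) (hb : Q.IsBounded b) :
    Q.IsBounded (a * b) := by
  rw [mul_eq_smul_sub]
  refine ((ha.add hb).mul_self.add ?_).smul _
  rw [sub_eq_add_neg]
  exact (ha.add hb.neg).mul_self.neg

/-- An element is bounded if its square is bounded above. -/
theorem isBounded_of_sub_mul_self_mem {a : A} {N : ℝ} (hN : 0 ≤ N)
    (h : algebraMap ℝ A N - a * a ∈ Q.carrier) : Q.IsBounded a := by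
  -- From `(N - a²) + (a ∓ 1)² = (N + 1) ∓ 2a`.
  refine ⟨2⁻¹ * (N + 1), by positivity, ?_, ?_⟩
  · convert Q.smul_mem' (c := (2⁻¹ : ℝ)) (by norm_num)
      (Q.add_mem' h (Q.sumSq_mem (.mul_self (a - 1)))) using 1
    rw [eq_inv_smul_iff₀ (by norm_num), Algebra.smul_def, ← map_one (algebraMap ℝ A), mul_sub,
      ← map_mul, mul_inv_cancel_left₀ (by norm_num), map_add, map_ofNat, map_one]
    ring
  · convert Q.smul_mem' (c := (2⁻¹ : ℝ)) (by norm_num)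
      (Q.add_mem' h (Q.sumSq_mem (.mul_self (a + 1)))) using 1
    rw [eq_inv_smul_iff₀ (by norm_num), Algebra.smul_def, ← map_one (algebraMap ℝ A), mul_add,
      ← map_mul, mul_inv_cancel_left₀ (by norm_num), map_add, map_ofNat, map_one]
    ring

/-- A quadratic module of polynomials that contains `M - y₁² - ⋯ - yₙ²` is archimedean. -/
theorem isArchimedean_of_ball_mem {ι : Type*} [Fintype ι] {Q : QuadModule (MvPolynomial ι ℝ)}
    {M : ℝ} (hM : 0 ≤ M)
    (h : MvPolynomial.C M - ∑ i, MvPolynomial.X i ^ 2 ∈ Q.carrier) : Q.IsArchimedean := by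
  classical
  intro p
  induction p using MvPolynomial.induction_on with
  | C a => exact Q.isBounded_algebraMap a
  | add p q hp hq => exact hp.add hq
  | mul_X p i hp =>
    -- Adding the squares of the other variables to the ball polynomial leaves `M - Xᵢ²`.
    refine hp.mul (isBounded_of_sub_mul_self_mem hM ?_)
    convert Q.add_mem' h (Q.sumSq_mem
      (IsSumSq.sum_sq (Finset.univ.erase i) (fun j => (MvPolynomial.X j : MvPolynomial ι ℝ))))
      using 1
    rw [← Finset.add_sum_erase Finset.univ _ (Finset.mem_univ i), MvPolynomial.algebraMap_eq]
    ring

end QuadModule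

/-! ### Positive functionals and Cauchy–Schwarz. -/

/-- Linear functionals that are nonnegative on a quadratic module. -/
def IsPositive (Q : QuadModule A) (L : A →ₗ[ℝ] ℝ) : Prop := ∀ q ∈ Q.carrier, 0 ≤ L q

theorem mul_sq_le_of_nonneg_mul_self (B : A →ₗ[ℝ] ℝ) (hB : ∀ a, 0 ≤ B (a * a)) (a b : A) :
    B (a * b) ^ 2 ≤ B (a * a) * B (b * b) := by
  have h : ∀ x : ℝ, 0 ≤ B (a * a) * (x * x) + (2 * B (a * b)) * x + B (b * b) := by
    intro x
    have e : (x • a + b) * (x • a + b) = (x * x) • (a * a) + (2 * x) • (a * b) + b * b := by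
      simp only [Algebra.smul_def, map_mul, map_ofNat]; ring
    have := hB (x • a + b)
    rw [e, map_add, map_add, map_smul, map_smul, smul_eq_mul, smul_eq_mul] at this
    linarith
  have := discrim_le_zero h
  rw [discrim] at this
  linarith

namespace IsPositive

variable {Q : QuadModule A} {L : A →ₗ[ℝ] ℝ}

theorem mul_self_nonneg (hL : IsPositive Q L) (a : A) : 0 ≤ L (a * a) :=
  hL _ (Q.sumSq_mem (.mul_self a))

theorem pow_le (hL : IsPositive Q L) {u : A} (hu : 1 - u * u ∈ Q.carrier) (m : ℕ) :
    L (u ^ m * u ^ m) ≤ L 1 := by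
  induction m with
  | zero => simp
  | succ m ih =>
    have h := hL _ (Q.mul_self_mul_mem (u ^ m) hu)
    rw [mul_sub, mul_one, map_sub] at h
    have e : u ^ (m + 1) * u ^ (m + 1) = u ^ m * u ^ m * (u * u) := by ring
    rw [e]; linarith

/-- If `1 - u²` lies in `Q`, then `(1 - u²) q` is nonnegative under every positive functional,
for every `q` in `Q`. -/
theorem mul_self_mul_le (hL : IsPositive Q L) {u : A} (hu : 1 - u * u ∈ Q.carrier) {q : A}
    (hq : q ∈ Q.carrier) : L (u * u * q) ≤ L q := by
  -- `(1 - u²) q` need not lie in `Q`, so growth rates are compared. `B` is nonnegative on squares;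
  -- if `B (u²) = r B 1` with `r > 1`, iterated Cauchy–Schwarz forces `B (u ^ 2 ^ (k+1)) ≥ r ^ 2 ^ k
  -- * B 1`. But Cauchy–Schwarz for `L` bounds these values, as `L (u ^ (2 * m)) ≤ L 1`.
  set B : A →ₗ[ℝ] ℝ := L ∘ₗ LinearMap.mulRight ℝ q with hBdef
  have hBapp : ∀ a, B a = L (a * q) := fun a => rfl
  have hB : ∀ a, 0 ≤ B (a * a) := fun a => hL _ (Q.mul_self_mul_mem a hq)
  have hB1 : B 1 = L q := by simp [hBapp]
  have hB0 : 0 ≤ B 1 := by simpa using hB 1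
  by_contra! hlt
  rw [← hB1, ← hBapp] at hlt
  have hcs : ∀ a, B a ^ 2 ≤ B 1 * B (a * a) := fun a => by
    simpa using mul_sq_le_of_nonneg_mul_self B hB 1 a
  have hpos : 0 < B 1 := by
    refine hB0.lt_of_ne fun h0 => ?_
    have := hcs (u * u)
    rw [← h0] at this hlt
    nlinarith
  set r := B (u * u) / B 1 with hr
  have hr1 : 1 < r := (one_lt_div hpos).2 hlt
  have hgrow : ∀ k : ℕ, B 1 * r ^ 2 ^ k ≤ B (u ^ 2 ^ k * u ^ 2 ^ k) := by
    intro k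
    induction k with
    | zero => simp [hr, mul_div_cancel₀ _ hpos.ne']
    | succ k ih =>
      have h1 := hcs (u ^ 2 ^ k * u ^ 2 ^ k)
      have e : u ^ 2 ^ (k + 1) = u ^ 2 ^ k * u ^ 2 ^ k := by rw [pow_succ, pow_mul, sq]
      rw [← e] at h1 ih
      have h2 : (B 1 * r ^ 2 ^ k) ^ 2 ≤ B (u ^ 2 ^ (k + 1)) ^ 2 :=
        pow_le_pow_left₀ (by positivity) ih 2
      have h3 : B 1 * (B 1 * r ^ 2 ^ (k + 1)) = (B 1 * r ^ 2 ^ k) ^ 2 := by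
        rw [mul_pow, ← pow_mul, ← pow_succ]; ring
      exact le_of_mul_le_mul_left (h3.trans_le (h2.trans h1)) hpos
  have hbdd : ∀ k : ℕ, B (u ^ 2 ^ k * u ^ 2 ^ k) ≤ L 1 * L (q * q) + 1 := by
    intro k
    have e : u ^ 2 ^ k * u ^ 2 ^ k = u ^ 2 ^ (k + 1) := by rw [pow_succ, pow_mul, sq]
    have h1 := mul_sq_le_of_nonneg_mul_self L hL.mul_self_nonneg (u ^ 2 ^ (k + 1)) q
    have h2 := mul_le_mul_of_nonneg_right (hL.pow_le hu (2 ^ (k + 1))) (hL.mul_self_nonneg q)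
    rw [e, hBapp]
    nlinarith [sq_nonneg (L (u ^ 2 ^ (k + 1) * q) - 1)]
  obtain ⟨k, hk⟩ := pow_unbounded_of_one_lt ((L 1 * L (q * q) + 1) / B 1) hr1
  have h1 : r ^ k ≤ r ^ 2 ^ k := pow_le_pow_right₀ hr1.le k.lt_two_pow_self.le
  rw [div_lt_iff₀' hpos] at hk
  have h2 := mul_le_mul_of_nonneg_left h1 hpos.le
  linarith [hgrow k, hbdd k]

/-- `N ± a ∈ Q` gives `|L a| ≤ N * L 1`. -/
theorem eq_zero_of_map_one (hQ : Q.IsArchimedean) (hL : IsPositive Q L) (h1 : L 1 = 0) :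
    L = 0 := by
  ext a
  obtain ⟨N, -, h₁, h₂⟩ := hQ a
  have h₁ := hL _ h₁
  have h₂ := hL _ h₂
  rw [Algebra.algebraMap_eq_smul_one, map_sub, map_smul, h1] at h₁
  rw [Algebra.algebraMap_eq_smul_one, map_add, map_smul, h1] at h₂
  simp only [smul_zero, zero_sub, zero_add] at h₁ h₂
  exact le_antisymm (neg_nonneg.1 h₁) h₂

end IsPositive

/-! ### States and their extreme points. -/

/-- The states of a quadratic module `Q`: linear functionals, regarded as functions, that are
nonnegative on `Q` and normalized at `1`. -/
def states (Q : QuadModule A) : Set (A → ℝ) :=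
  {g | ∃ L : A →ₗ[ℝ] ℝ, ⇑L = g ∧ IsPositive Q L ∧ L 1 = 1}

variable {Q : QuadModule A}

theorem isClosed_states (Q : QuadModule A) : IsClosed (states Q) := by
  have e : states Q = (⋂ a, ⋂ b, {g : A → ℝ | g (a + b) = g a + g b}) ∩
      (⋂ c : ℝ, ⋂ a, {g : A → ℝ | g (c • a) = c * g a}) ∩
      (⋂ q ∈ Q.carrier, {g : A → ℝ | 0 ≤ g q}) ∩ {g : A → ℝ | g 1 = 1} := by
    ext g
    simp only [Set.mem_inter_iff, Set.mem_iInter, Set.mem_ofPred_eq]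
    constructor
    · rintro ⟨L, rfl, hL, h1⟩
      exact ⟨⟨⟨fun a b => map_add L a b, fun c a => map_smul L c a⟩, hL⟩, h1⟩
    · rintro ⟨⟨⟨hadd, hsmul⟩, hpos⟩, h1⟩
      exact ⟨⟨⟨g, hadd⟩, hsmul⟩, rfl, hpos, h1⟩
  rw [e]
  refine ((IsClosed.inter ?_ ?_).inter ?_).inter ?_
  · exact isClosed_iInter fun a => isClosed_iInter fun b =>
      isClosed_eq (continuous_apply _) (by fun_prop)
  · exact isClosed_iInter fun c => isClosed_iInter fun a =>
      isClosed_eq (continuous_apply _) (continuous_const.mul (continuous_apply _))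
  · exact isClosed_iInter fun q => isClosed_iInter fun _ =>
      isClosed_le continuous_const (continuous_apply _)
  · exact isClosed_eq (continuous_apply _) continuous_const

/-- Tychonoff: boundedness of each `a` confines states to a product of intervals, where they form a
closed set for pointwise convergence. -/
theorem isCompact_states (hQ : Q.IsArchimedean) : IsCompact (states Q) := by
  choose N _ h₁ h₂ using hQ
  refine (isCompact_univ_pi fun a => isCompact_Icc (a := -N a) (b := N a)).of_isClosed_subset
    (isClosed_states Q) ?_
  rintro g ⟨L, rfl, hL, h1⟩ a -
  have h₁ := hL _ (h₁ a)
  have h₂ := hL _ (h₂ a)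
  rw [Algebra.algebraMap_eq_smul_one, map_sub, map_smul, h1, smul_eq_mul, mul_one] at h₁
  rw [Algebra.algebraMap_eq_smul_one, map_add, map_smul, h1, smul_eq_mul, mul_one] at h₂
  exact ⟨by linarith, by linarith⟩

/-- A positive functional dominated by an extreme state is a multiple of it. -/
theorem eq_smul_of_mem_extremePoints (hQ : Q.IsArchimedean) {L T : A →ₗ[ℝ] ℝ}
    (hext : ⇑L ∈ (states Q).extremePoints ℝ) (hT : IsPositive Q T) (hLT : IsPositive Q (L - T)) :
    T = T 1 • L := by
  rw [mem_extremePoints] at hext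
  obtain ⟨⟨L', hL', -, h1⟩, hext⟩ := hext
  obtain rfl : L' = L := DFunLike.coe_injective hL'
  have hT1 := hT _ Q.one_mem'
  have hLT1 := hLT _ Q.one_mem'
  rw [LinearMap.sub_apply, h1] at hLT1
  rcases hT1.eq_or_lt with h0 | h0
  · rw [← h0, zero_smul]
    exact hT.eq_zero_of_map_one hQ h0.symm
  rcases hLT1.eq_or_lt with h2 | h2
  · have := hLT.eq_zero_of_map_one hQ (by simp [h1, ← h2])
    rw [show T 1 = 1 by linarith, one_smul, sub_eq_zero.1 this]
  -- `L` is the convex combination of the normalizations of `T` and `L - T`, with weights `T 1` and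
  -- `1 - T 1`.
  have key := hext (⇑((T 1)⁻¹ • T))
    ⟨_, rfl, fun q hq => mul_nonneg (inv_nonneg.2 hT1) (hT q hq), by simp [h0.ne']⟩
    (⇑((1 - T 1)⁻¹ • (L' - T)))
    ⟨_, rfl, fun q hq => mul_nonneg (inv_nonneg.2 hLT1) (hLT q hq), by simp [h1, h2.ne']⟩
    ⟨T 1, 1 - T 1, h0, h2, by ring, by
      rw [← LinearMap.coe_smul, ← LinearMap.coe_smul, smul_inv_smul₀ h0.ne',
        smul_inv_smul₀ h2.ne']
      exact add_sub_cancel _ _⟩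
  have := DFunLike.coe_injective key.1
  rw [← this, smul_inv_smul₀ h0.ne']

/-- When `N - p² ∈ Q`, the positive functional `a ↦ N⁻¹ L (p² a)` is dominated by `L`, hence a
multiple of it by extremality. -/
theorem map_mul_self_mul_of_mem_extremePoints (hQ : Q.IsArchimedean) {L : A →ₗ[ℝ] ℝ}
    (hext : ⇑L ∈ (states Q).extremePoints ℝ) (p a : A) :
    L (p * p * a) = L (p * p) * L a := by
  obtain ⟨L', hL', hpos, h1⟩ := (mem_extremePoints.1 hext).1
  obtain rfl : L' = L := DFunLike.coe_injective hL'
  obtain ⟨N, hN, hNp, -⟩ := hQ (p * p)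
  set c := (Real.sqrt N)⁻¹ with hc
  have hcc : c * c = N⁻¹ := by rw [hc, ← mul_inv, Real.mul_self_sqrt hN.le]
  have hu : (c • p) * (c • p) = N⁻¹ • (p * p) := by rw [smul_mul_smul_comm, hcc]
  have hu1 : 1 - (c • p) * (c • p) ∈ Q.carrier := by
    convert Q.smul_mem' (inv_pos.2 hN) hNp using 1
    rw [hu, smul_sub, Algebra.algebraMap_eq_smul_one, inv_smul_smul₀ hN.ne']
  have key := eq_smul_of_mem_extremePoints hQ hext
    (T := L' ∘ₗ LinearMap.mulLeft ℝ ((c • p) * (c • p)))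
    (fun q hq => hpos _ (Q.mul_self_mul_mem _ hq))
    (fun q hq => sub_nonneg.2 (hpos.mul_self_mul_le hu1 hq))
  have := LinearMap.congr_fun key a
  simp only [LinearMap.comp_apply, LinearMap.mulLeft_apply, LinearMap.smul_apply, mul_one, hu,
    smul_mul_assoc, map_smul, smul_eq_mul] at this
  rw [mul_assoc N⁻¹] at this
  exact mul_left_cancel₀ (inv_ne_zero hN.ne') this

/-- Extreme states of an archimedean quadratic module are multiplicative. -/
theorem exists_algHom_of_mem_extremePoints (hQ : Q.IsArchimedean) {g : A → ℝ}
    (hext : g ∈ (states Q).extremePoints ℝ) : ∃ φ : A →ₐ[ℝ] ℝ, ⇑φ = g := by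
  obtain ⟨L, rfl, -, h1⟩ := (mem_extremePoints.1 hext).1
  refine ⟨AlgHom.ofLinearMap L h1 fun a b => ?_, rfl⟩
  have hmul := map_mul_self_mul_of_mem_extremePoints hQ hext
  -- Writing `a = ((a+1)² - (a-1)²)/4` reduces multiplicativity to a square factor.
  have e := QuadModule.mul_eq_smul_sub a 1
  rw [mul_one] at e
  conv_lhs => rw [e]
  conv_rhs => rw [e]
  rw [smul_mul_assoc, map_smul, add_mul, neg_mul, map_add, map_neg, hmul, hmul, map_smul, map_add,
    map_neg]
  simp only [smul_eq_mul]
  ring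

/-! ### Separation and the Positivstellensätze. -/

/-- An element outside of an archimedean quadratic module is nonpositive under some state. -/
theorem exists_state_nonpos (hQ : Q.IsArchimedean) {f : A} (hf : f ∉ Q.carrier) :
    ∃ L : A →ₗ[ℝ] ℝ, IsPositive Q L ∧ L 1 = 1 ∧ L f ≤ 0 := by
  -- Otherwise `f = (N + f) + N(-1)` would lie in `Q`.
  have hneg : (-1 : A) ∉ Q.carrier := by
    intro h
    obtain ⟨N, hN, -, h₂⟩ := hQ f
    apply hf
    convert Q.add_mem' h₂ (Q.smul_mem' hN h) using 1
    rw [smul_neg, Algebra.algebraMap_eq_smul_one]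
    abel
  have h10 : (1 : A) ≠ 0 := by
    intro h
    apply hneg
    rw [h, neg_zero]
    exact Q.zero_mem
  -- The cone `Q - ℝ≥0 f`. It contains no negative constant, since that would put `-1` or `f` in
  -- `Q`; so `1 ↦ 1` extends to a functional nonnegative on `Q` and on `-f`.
  let s : PointedCone ℝ A :=
    { carrier := {a | ∃ c : ℝ, 0 ≤ c ∧ a + c • f ∈ Q.carrier}
      zero_mem' := ⟨0, le_rfl, by simpa using Q.zero_mem⟩
      add_mem' := by
        rintro a b ⟨c, hc, ha⟩ ⟨d, hd, hb⟩
        refine ⟨c + d, by positivity, ?_⟩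
        convert Q.add_mem' ha hb using 1
        rw [add_smul]; abel
      smul_mem' := by
        rintro ⟨r, hr⟩ a ⟨c, hc, ha⟩
        refine ⟨r * c, mul_nonneg hr hc, ?_⟩
        convert Q.smul_mem_of_nonneg hr ha using 1
        rw [smul_add, mul_smul]
        rfl }
  have hmem : ∀ a, a ∈ s ↔ ∃ c : ℝ, 0 ≤ c ∧ a + c • f ∈ Q.carrier := fun a => Iff.rfl
  obtain ⟨L, hL, hpos⟩ := riesz_extension s (LinearPMap.mkSpanSingleton (1 : A) (1 : ℝ) h10)
    (by
      rintro ⟨x, hx⟩ hxs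
      obtain ⟨t, rfl⟩ := Submodule.mem_span_singleton.1 hx
      obtain ⟨c, hc, hmem⟩ := (hmem _).1 hxs
      rw [LinearPMap.mkSpanSingleton'_apply]
      simp only [RingHom.id_apply, smul_eq_mul, mul_one]
      by_contra! ht
      have h' := Q.add_mem' hmem (Q.smul_mem' (neg_pos.2 ht) Q.one_mem')
      rw [neg_smul, add_right_comm, add_neg_cancel, zero_add] at h'
      rcases hc.eq_or_lt with rfl | hc
      · apply hneg
        convert Q.smul_mem' (inv_pos.2 (neg_pos.2 ht)) hmem using 1
        rw [zero_smul, add_zero, smul_smul, inv_neg, neg_mul, inv_mul_cancel₀ ht.ne, neg_smul,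
          one_smul]
      · apply hf
        convert Q.smul_mem' (inv_pos.2 hc) h' using 1
        rw [inv_smul_smul₀ hc.ne'])
    (by
      intro y
      obtain ⟨N, -, -, h₂⟩ := hQ y
      refine ⟨⟨N • 1, Submodule.smul_mem _ _ (Submodule.mem_span_singleton_self 1)⟩, 0, le_rfl, ?_⟩
      simpa [Algebra.algebraMap_eq_smul_one] using h₂)
  refine ⟨L, fun q hq => hpos q ⟨0, le_rfl, by simpa using hq⟩, ?_, ?_⟩
  · rw [hL ⟨1, Submodule.mem_span_singleton_self 1⟩]
    exact LinearPMap.mkSpanSingleton_apply ℝ ℝ h10 1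
  · have := hpos (-f) ⟨1, zero_le_one, by simpa using Q.zero_mem⟩
    rw [map_neg] at this
    linarith

/-- **Archimedean Positivstellensatz** (Jacobi, Putinar): an element that is positive at all real
points at which the archimedean quadratic module `Q` is nonnegative lies in `Q`. -/
theorem mem_of_forall_algHom_pos (hQ : Q.IsArchimedean) {f : A}
    (hf : ∀ φ : A →ₐ[ℝ] ℝ, (∀ q ∈ Q.carrier, 0 ≤ φ q) → 0 < φ f) : f ∈ Q.carrier := by
  by_contra hfQ
  obtain ⟨L, hL, h1, hLf⟩ := exists_state_nonpos hQ hfQ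
  -- The exposed face of states minimizing the value at `f`: it is compact, and its extreme points
  -- are extreme in all of `states Q`.
  have hexp : IsExposed ℝ (states Q) {g ∈ states Q | ∀ k ∈ states Q, (-ContinuousLinearMap.proj
    (R := ℝ) (φ := fun _ : A => ℝ) f) k ≤ (-ContinuousLinearMap.proj f) g} := fun _ => ⟨_, rfl⟩
  obtain ⟨g₀, hg₀, hmin⟩ := (isCompact_states hQ).exists_isMaxOn ⟨L, L, rfl, hL, h1⟩
    (-ContinuousLinearMap.proj (R := ℝ) (φ := fun _ : A => ℝ) f).continuous.continuousOn
  obtain ⟨g, hg⟩ := (hexp.isCompact (isCompact_states hQ)).extremePoints_nonempty ⟨g₀, hg₀, hmin⟩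
  have hgf : g f ≤ L f := by
    simpa using (extremePoints_subset hg).2 L ⟨L, rfl, hL, h1⟩
  have hext := hexp.isExtreme.extremePoints_subset_extremePoints hg
  obtain ⟨φ, rfl⟩ := exists_algHom_of_mem_extremePoints hQ hext
  obtain ⟨L', hL', hpos, -⟩ := extremePoints_subset hext
  refine (hf φ fun q hq => ?_).not_ge (hgf.trans hLf)
  rw [← hL']
  exact hpos q hq

/-- The quadratic module generated by a family of elements. -/
def QuadModule.generate {ι : Type*} (w : ι → A) : QuadModule A where
  carrier := {p | ∃ (σ : A) (τ : ι →₀ A), IsSumSq σ ∧ (∀ i, IsSumSq (τ i)) ∧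
    p = σ + τ.sum fun i t => w i * t}
  smul_mem' := by
    rintro c hc _ ⟨σ, τ, hσ, hτ, rfl⟩
    have hC : IsSumSq (algebraMap ℝ A c) := by
      rw [← Real.mul_self_sqrt hc.le, map_mul]
      exact .mul_self _
    refine ⟨c • σ, c • τ, ?_, fun i => ?_, ?_⟩
    · rw [Algebra.smul_def]; exact hC.mul hσ
    · rw [Finsupp.smul_apply, Algebra.smul_def]; exact hC.mul (hτ i)
    · rw [Finsupp.sum_smul_index' (by simp), smul_add, Finsupp.smul_sum]
      simp only [mul_smul_comm]
  add_mem' := by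
    classical
    rintro _ ⟨σ, τ, hσ, hτ, rfl⟩ _ ⟨σ', τ', hσ', hτ', rfl⟩
    refine ⟨σ + σ', τ + τ', hσ.add hσ', fun i => (hτ i).add (hτ' i), ?_⟩
    rw [Finsupp.sum_add_index' (by simp) (fun _ _ _ => mul_add _ _ _)]
    abel
  one_mem' := ⟨1, 0, .one, fun _ => .zero, by simp⟩
  sumSq_mul_mem' := by
    rintro s _ hs ⟨σ, τ, hσ, hτ, rfl⟩
    refine ⟨s * σ, τ.mapRange (s * ·) (mul_zero s), hs.mul hσ, fun i => ?_, ?_⟩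
    · rw [Finsupp.mapRange_apply]; exact hs.mul (hτ i)
    · rw [Finsupp.sum_mapRange_index (by simp), mul_add, Finsupp.mul_sum]
      simp only [mul_left_comm]

theorem QuadModule.mem_generate {ι : Type*} (w : ι → A) (i : ι) :
    w i ∈ (QuadModule.generate w).carrier := by
  classical
  refine ⟨0, Finsupp.single i 1, .zero, fun j => ?_, by simp⟩
  rw [Finsupp.single_apply]
  split_ifs
  · exact .one
  · exact .zero

end Archimedean

/-- **Putinar's Positivstellensatz** for a possibly infinite family of constraints and a ball. -/
theorem exists_putinar_representation {n : ℕ} {J : Type*} (v : J → MvPolynomial (Fin n) ℝ)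
    {M : ℝ} (hM : 0 ≤ M) {f : MvPolynomial (Fin n) ℝ}
    (hf : ∀ y : Fin n → ℝ, (∀ i, 0 ≤ MvPolynomial.eval y (v i)) → ∑ i, y i ^ 2 ≤ M →
      0 < MvPolynomial.eval y f) :
    ∃ (σ σ₀ : MvPolynomial (Fin n) ℝ) (τ : J →₀ MvPolynomial (Fin n) ℝ),
      IsSumSq σ ∧ IsSumSq σ₀ ∧ (∀ i, IsSumSq (τ i)) ∧
      f = σ + (MvPolynomial.C M - ∑ i, MvPolynomial.X i ^ 2) * σ₀ +
        τ.sum fun i t => v i * t := by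
  set b : MvPolynomial (Fin n) ℝ := MvPolynomial.C M - ∑ i, MvPolynomial.X i ^ 2 with hb
  -- The index `none` carries the ball constraint.
  set w : Option J → MvPolynomial (Fin n) ℝ := fun o => o.elim b v with hw
  have harch : (QuadModule.generate w).IsArchimedean :=
    QuadModule.isArchimedean_of_ball_mem hM (QuadModule.mem_generate w none)
  obtain ⟨σ, τ, hσ, hτ, rfl⟩ := mem_of_forall_algHom_pos harch (f := f) (by
    intro φ hφ
    -- Real homomorphisms of the polynomial algebra are point evaluations.
    have hev : ∀ p, φ p = MvPolynomial.eval (φ ∘ MvPolynomial.X) p := fun p => by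
      conv_lhs => rw [MvPolynomial.aeval_unique φ]
      rw [MvPolynomial.aeval_eq_eval]
    rw [hev]
    refine hf _ (fun i => ?_) ?_
    · rw [← hev]
      exact hφ _ (QuadModule.mem_generate w (some i))
    · have := hφ _ (QuadModule.mem_generate w none)
      rw [hev] at this
      simpa [hw, hb] using this)
  refine ⟨σ, τ none, τ.some, hσ, hτ none, fun i => hτ (some i), ?_⟩
  rw [Finsupp.sum_option_index _ _ (by simp) (fun _ _ _ => mul_add _ _ _), add_assoc]
  rfl

/-! ### Closed sets and transfer along `h`. -/

/-- A closed subset of `ℝⁿ` is described by countably many polynomial inequalities. -/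
theorem exists_nat_family_of_isClosed {n : ℕ} {K : Set (Fin n → ℝ)} (hK : IsClosed K) :
    ∃ v : ℕ → MvPolynomial (Fin n) ℝ,
      {y : Fin n → ℝ | ∀ i, 0 ≤ MvPolynomial.eval y (v i)} = K := by
  have hex : ∀ y : (Kᶜ : Set (Fin n → ℝ)), ∃ p : MvPolynomial (Fin n) ℝ,
      (∀ z ∈ K, 0 ≤ MvPolynomial.eval z p) ∧ MvPolynomial.eval y.1 p < 0 := by
    rintro ⟨y, hy⟩
    obtain ⟨ε, hε, hball⟩ := Metric.isOpen_iff.1 hK.isOpen_compl y hy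
    -- The metric is the sup distance, which the Euclidean one dominates, so this is nonnegative off
    -- the `ε`-ball around `y`.
    refine ⟨∑ i, (MvPolynomial.X i - MvPolynomial.C (y i)) ^ 2 - MvPolynomial.C (ε ^ 2),
      fun z hz => ?_, ?_⟩
    · have hd : ¬ dist z y < ε := fun h => hball h hz
      rw [dist_pi_lt_iff hε] at hd
      push Not at hd
      obtain ⟨i, hi⟩ := hd
      have h1 : ε ^ 2 ≤ (z i - y i) ^ 2 := by
        rw [← sq_abs (z i - y i), ← Real.dist_eq]
        exact pow_le_pow_left₀ hε.le hi 2
      have h2 := Finset.single_le_sum (f := fun i => (z i - y i) ^ 2)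
        (fun i _ => sq_nonneg _) (Finset.mem_univ i)
      simp only [map_sub, map_sum, map_pow, MvPolynomial.eval_X, MvPolynomial.eval_C]
      linarith
    · simp [hε]
  choose p hp hpneg using hex
  -- Lindelöf: countably many of the sets `{p y < 0}` already cover the complement of `K`.
  obtain ⟨T, hT, hTU⟩ := TopologicalSpace.isOpen_iUnion_countable
    (fun y : (Kᶜ : Set (Fin n → ℝ)) => {z : Fin n → ℝ | MvPolynomial.eval z (p y) < 0})
    (fun y => isOpen_lt (MvPolynomial.continuous_eval _) continuous_const)
  -- The harmless constraint `0` makes the family nonempty, so `ℕ` can enumerate it even if `T` is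
  -- empty.
  obtain ⟨v, hv⟩ := ((hT.image p).insert 0).exists_eq_range (Set.insert_nonempty _ _)
  refine ⟨v, Set.ext fun z => ⟨fun hz => ?_, fun hz i => ?_⟩⟩
  · by_contra hzK
    have hmem : z ∈ ⋃ y ∈ T, {z : Fin n → ℝ | MvPolynomial.eval z (p y) < 0} := by
      rw [hTU]
      exact Set.mem_iUnion.2 ⟨⟨z, hzK⟩, hpneg ⟨z, hzK⟩⟩
    obtain ⟨y, hyT, hy⟩ := Set.mem_iUnion₂.1 hmem
    obtain ⟨i, hi⟩ : p y ∈ Set.range v := hv ▸ Set.mem_insert_of_mem _ ⟨y, hyT, rfl⟩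
    have := hz i
    rw [hi] at this
    exact (lt_irrefl _ (this.trans_lt hy)).elim
  · have hi : v i ∈ insert 0 (p '' T) := hv ▸ ⟨i, rfl⟩
    rcases hi with hi | ⟨y, -, hy⟩
    · simp [hi]
    · rw [← hy]
      exact hp y z hz

theorem isClosed_polyPosSet {n : ℕ} (Q : QuadModule (MvPolynomial (Fin n) ℝ)) :
    IsClosed (polyPosSet Q) := by
  simp only [polyPosSet, Set.ofPred_forall]
  exact isClosed_iInter fun p => isClosed_iInter fun _ =>
    isClosed_le continuous_const (MvPolynomial.continuous_eval p)

theorem subst_surjective {X : Type*} {n : ℕ} (h : X → Fin n → ℝ) :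
    Function.Surjective (subst h) := by
  rintro ⟨q, hq⟩
  have hrange : (genAlgebra h).val.comp (subst h) = MvPolynomial.aeval fun i x => h x i := by
    ext i x
    simp [subst, gen]
  rw [genAlgebra, Algebra.adjoin_range_eq_range_aeval, ← hrange] at hq
  obtain ⟨p, hp⟩ := hq
  exact ⟨p, Subtype.ext hp⟩

theorem mem_posSet_of_mem_polyPosSet {X : Type*} {n : ℕ} {h : X → Fin n → ℝ}
    {Q : QuadModule (genAlgebra h)} {x : X} (hx : h x ∈ polyPosSet (Q.comap (subst h))) :
    x ∈ posSet Q := by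
  intro q hq
  obtain ⟨p, rfl⟩ := subst_surjective h q
  rw [subst_apply]
  exact hx p hq

end FunctionAlgebra

theorem mainTheorem3 {d n : ℕ} (X : Set (Fin d → ℝ)) (hX : MeasurableSet X)
    (h : X → Fin n → ℝ) (hmeas : Measurable h)
    (Q : FunctionAlgebra.QuadModule (FunctionAlgebra.genAlgebra h))
    (hQ : FunctionAlgebra.InAlgebraicInterior Q.carrier 1)
    (hclosed : IsClosed (Set.range h)) :
    (∃ v : ℕ → MvPolynomial (Fin n) ℝ,
      {y : Fin n → ℝ | ∀ i, 0 ≤ MvPolynomial.eval y (v i)} =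
        Set.range h ∩
          FunctionAlgebra.polyPosSet (Q.comap (FunctionAlgebra.subst h))) ∧
    ∀ (J : Type*) [Countable J] (v : J → MvPolynomial (Fin n) ℝ),
      {y : Fin n → ℝ | ∀ i, 0 ≤ MvPolynomial.eval y (v i)} =
        Set.range h ∩
          FunctionAlgebra.polyPosSet (Q.comap (FunctionAlgebra.subst h)) →
      ∀ M : ℝ, 0 < M →
      ∀ f : MvPolynomial (Fin n) ℝ,
        (∀ x ∈ FunctionAlgebra.posSet Q, 0 < MvPolynomial.eval (h x) f) →
        ∃ (J₀ : Finset J) (σ σ₀ : MvPolynomial (Fin n) ℝ) (τ : J → MvPolynomial (Fin n) ℝ),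
          IsSumSq σ ∧ IsSumSq σ₀ ∧ (∀ i ∈ J₀, IsSumSq (τ i)) ∧
          ∀ x : X, MvPolynomial.eval (h x) f =
            MvPolynomial.eval (h x) σ +
            (M - ∑ i : Fin n, h x i ^ 2) * MvPolynomial.eval (h x) σ₀ +
            ∑ i ∈ J₀, MvPolynomial.eval (h x) (v i) * MvPolynomial.eval (h x) (τ i) := by
  refine ⟨FunctionAlgebra.exists_nat_family_of_isClosed
    (hclosed.inter (FunctionAlgebra.isClosed_polyPosSet _)), ?_⟩
  intro J _ v hv M hM f hf
  obtain ⟨σ, σ₀, τ, hσ, hσ₀, hτ, rfl⟩ :=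
    FunctionAlgebra.exists_putinar_representation v hM.le (f := f) (by
      intro y hy _
      obtain ⟨⟨x, rfl⟩, hx⟩ := hv.subset hy
      exact hf x (FunctionAlgebra.mem_posSet_of_mem_polyPosSet hx))
  refine ⟨τ.support, σ, σ₀, τ, hσ, hσ₀, fun i _ => hτ i, fun x => ?_⟩
  simp [Finsupp.sum]
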